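/- Let $K$ be a field, let $X=(X_{ij})$ be an $m\times n$ matrix of distinct indeterminates over $K$ and let $K[X]=K[X_{ij}:1\le i\le m,\ 1\le j\le n]$. Let $1\le k\le l\le n$ with $l-k+1\ge m$, and let $Y_{kl}$ be the submatrix of $X$ consisting of the columns $k,k+1,\dots,l$. A diagonal monomial of $Y_{kl}$ is a product $X_{1c_1}X_{2c_2}\cdots X_{mc_m}$ with $k\le c_1<c_2<\cdots<c_m\le l$; let $J_{kl}$ be the ideal of $K[X]$ generated by all diagonal monomials of $Y_{kl}$. (1) Let $\tau$ be a monomial order on $K[X]$ with $X_{i1}>X_{i2}>\cdots>X_{in}$ for every $1\le i\le m$ (for example the diagonal term order given by the lexicographic order induced by $X_{11}>X_{12}>\cdots>X_{1n}>X_{21}>\cdots>X_{2n}>\cdots>X_{m1}>\cdots>X_{mn}$). Let $f_1>\cdots>f_r$ be all the diagonal monomials of $Y_{kl}$, ordered by $\tau$. If $0\le u\le r-1$ and $f_{u+1}=X_{1c_1}X_{2c_2}\cdots X_{mc_m}$, then, with $c_0:=k-1$, $$(\langle f_1,\dots,f_u\rangle : f_{u+1})=\langle X_{ib} : 1\le i\le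 m,\ c_{i-1}<b<c_i\rangle .$$ (2) The ideal $J_{kl}$ has linear quotients, that is, it has generators $g_1,\dots,g_r$ such that $(\langle g_1,\dots,g_u\rangle:g_{u+1})$ is generated by linear forms for every $1\le u\le r-1$. (3) The ideal $J_{kl}$ has a linear free resolution, that is, with $S=K[X]$ there is a graded exact sequence $\cdots\to S(-m-2)^{\beta_2}\to S(-m-1)^{\beta_1}\to S(-m)^{\beta_0}\to J_{kl}\to 0$ with finite ranks $\beta_i$ (its differentials are then given by matrices of linear forms, so it is the minimal graded free resolution). -/

import Mathlib

/-!
The generic `m × n` matrix has the variables `X (i, j)` with `i : Fin m`, `j : Fin n` as entries, so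
that rows and columns are numbered from `0`.  In particular the submatrix on the consecutive
columns from `k` to `l` is given by `k l : Fin n`.
-/

namespace DiagonalIdeals

open MvPolynomial

/-- The column sequences `k ≤ c₁ < c₂ < ⋯ < cₘ ≤ l` of the maximal minors of the submatrix on the
columns `k, …, l`. -/
def IsColumnSeq {m n : ℕ} (k l : Fin n) (c : Fin m → Fin n) : Prop :=
  StrictMono c ∧ ∀ i, k ≤ c i ∧ c i ≤ l

/-- The product of the main diagonal entries of the maximal submatrix with columns `c`. -/
noncomputable def diagMonomial (K : Type*) [Field K] {m n : ℕ} (c : Fin m → Fin n) :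
    MvPolynomial (Fin m × Fin n) K :=
  ∏ i, X (i, c i)

/-- The set of all diagonal monomials of the submatrix on the columns `k, …, l`. -/
noncomputable def diagMonomials (K : Type*) [Field K] (m : ℕ) {n : ℕ} (k l : Fin n) :
    Set (MvPolynomial (Fin m × Fin n) K) :=
  {f | ∃ c : Fin m → Fin n, IsColumnSeq k l c ∧ f = diagMonomial K c}

/-- The ideal `J_{kl}` of `K[X]`. -/
noncomputable def diagIdeal (K : Type*) [Field K] (m : ℕ) {n : ℕ} (k l : Fin n) :
    Ideal (MvPolynomial (Fin m × Fin n) K) :=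
  Ideal.span (diagMonomials K m k l)

/-- The variables `X_{i b}` with `c_{i-1} < b < c_i`, where `c₀ = k - 1`: the bound by `k` is the
one for the first row, and it follows from the other one in the later rows. -/
noncomputable def gapVariables (K : Type*) [Field K] {m n : ℕ} (k : Fin n) (c : Fin m → Fin n) :
    Set (MvPolynomial (Fin m × Fin n) K) :=
  {x | ∃ (i : Fin m) (b : Fin n),
    k ≤ b ∧ (∀ i' : Fin m, i'.val + 1 = i.val → c i' < b) ∧ b < c i ∧ x = X (i, b)}

/-- In each row of the matrix the monomial order satisfies `X_{i1} > X_{i2} > ⋯ > X_{in}`. -/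
def IsRowDecreasing {m n : ℕ} (τ : MonomialOrder (Fin m × Fin n)) : Prop :=
  ∀ (i : Fin m) (a b : Fin n), a < b →
    τ.toSyn (Finsupp.single (i, b) 1) < τ.toSyn (Finsupp.single (i, a) 1)

/-- `f` lists the diagonal monomials of the submatrix on the columns `k, …, l` in strictly
decreasing order with respect to `τ`. -/
def IsDecreasingEnumeration {K : Type*} [Field K] {m n : ℕ} (τ : MonomialOrder (Fin m × Fin n))
    (k l : Fin n) {r : ℕ} (f : Fin r → MvPolynomial (Fin m × Fin n) K) : Prop :=
  Set.range f = diagMonomials K m k l ∧ StrictAnti fun u => τ.toSyn (τ.degree (f u))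

/-- The colon ideal `(⟨f_v : v < u⟩ : f_u)`. -/
noncomputable def successiveColon {σ K : Type*} [Field K] {r : ℕ} (f : Fin r → MvPolynomial σ K) (u : Fin r) :
    Ideal (MvPolynomial σ K) :=
  (Ideal.span (f '' Set.Iio u)).colon {f u}

/-- `I` has linear quotients: it has an ordered system of generators such that each successive
colon ideal, from the second generator on, is generated by linear forms. -/
def HasLinearQuotients {σ K : Type*} [Field K] (I : Ideal (MvPolynomial σ K)) : Prop :=
  ∃ (r : ℕ) (f : Fin r → MvPolynomial σ K), Ideal.span (Set.range f) = I ∧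
    ∀ u : Fin r, 0 < u.val → ∃ L : Set (MvPolynomial σ K),
      (∀ p ∈ L, p.IsHomogeneous 1) ∧ successiveColon f u = Ideal.span L

/-- `I` has a `d`-linear free resolution
`⋯ → S(-d-2)^{β₂} → S(-d-1)^{β₁} → S(-d)^{β₀} → I → 0` over `S = K[X]`: the augmentation is given by
forms of degree `d` and the differentials are given by matrices of linear forms (so that the
resolution is graded and minimal). -/
def HasLinearResolution {σ K : Type*} [Field K] (d : ℕ) (I : Ideal (MvPolynomial σ K)) : Prop :=
  ∃ (β : ℕ → ℕ) (g : Fin (β 0) → MvPolynomial σ K)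
    (M : ∀ i : ℕ, Matrix (Fin (β i)) (Fin (β (i + 1))) (MvPolynomial σ K)),
    (∀ a, (g a).IsHomogeneous d) ∧
    (∀ i a b, (M i a b).IsHomogeneous 1) ∧
    Ideal.span (Set.range g) = I ∧
    Function.Exact (M 0).mulVecLin (Fintype.linearCombination (MvPolynomial σ K) g) ∧
    ∀ i, Function.Exact (M (i + 1)).mulVecLin (M i).mulVecLin

end DiagonalIdeals

/-!
The colon ideals of a family of monomials are read off from exponent vectors. If `c'` arises from
`c` by moving the column of row `i` into the gap to its left, then `X (i, c' i)` times the diagonal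
monomial of `c` is a multiple of the diagonal monomial of `c'`, so all gap variables lie in the colon
ideal as soon as pointwise smaller column sequences come first. Conversely, if `c'` comes before
`c` and is not pointwise at least `c`, then in the first row with `c' i < c i` the entry `c' i` lies
in a gap of `c`, so that every monomial in the colon ideal is divisible by a gap variable
(`successiveColon_eq_span_gapVariables`). Both conditions hold for the decreasing enumeration with
respect to a row decreasing monomial order, and also for the lexicographic enumeration of the
column sequences, which gives linear quotients without the choice of a monomial order.

The linear resolution is an iterated mapping cone. If `I` has a `d`-linear resolution, `f` is a form
of degree `d` and `I : f` has a `1`-linear resolution, then the isomorphism of `(I + ⟨f⟩) / I` with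
`K[X] / (I : f)`, shifted by `d`, shows that the cone of a comparison map is a `d`-linear resolution of
`I + ⟨f⟩` (`HasLinearResolution.sup_span_singleton`); the comparison map can be chosen with linear
entries because homogeneous elements of the image of a homogeneous matrix have homogeneous
preimages. The same lemma provides the Koszul resolution of an ideal generated by variables,
since a further variable is a nonzerodivisor modulo the others, and then, along the colon
ideals computed before, the resolution of the diagonal ideal.
-/

namespace DiagonalIdeals

open MvPolynomial

/-! ### Diagonal monomials and their colon ideals -/

section Monomials

variable {m n : ℕ}

/-- The exponent vector of the diagonal monomial with columns `c`. -/
noncomputable def diagExponent (c : Fin m → Fin n) : Fin m × Fin n →₀ ℕ :=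
  ∑ i, Finsupp.single (i, c i) 1

theorem diagMonomial_eq_monomial (K : Type*) [Field K] (c : Fin m → Fin n) :
    diagMonomial K c = monomial (diagExponent c) 1 := by
  simp only [diagMonomial, diagExponent, monomial_sum_one]
  rfl

theorem diagExponent_apply (c : Fin m → Fin n) (i : Fin m) (b : Fin n) :
    diagExponent c (i, b) = if c i = b then 1 else 0 := by
  classical
  simp only [diagExponent, Finsupp.finsetSum_apply, Finsupp.single_apply, Prod.mk.injEq]
  rw [Finset.sum_eq_single i]
  · simp
  · intro j _ hj
    simp [hj]
  · simp

theorem isHomogeneous_diagMonomial (K : Type*) [Field K] (c : Fin m → Fin n) :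
    (diagMonomial K c).IsHomogeneous m := by
  simpa using! IsHomogeneous.prod Finset.univ (fun i => (X (i, c i) : MvPolynomial _ K))
    (fun _ => 1) fun i _ => isHomogeneous_X K _

/-- The positions of the variables in `gapVariables`. -/
def gapPositions (k : Fin n) (c : Fin m → Fin n) : Set (Fin m × Fin n) :=
  {p | k ≤ p.2 ∧ (∀ i' : Fin m, i'.val + 1 = p.1.val → c i' < p.2) ∧ p.2 < c p.1}

theorem gapVariables_eq_image (K : Type*) [Field K] (k : Fin n) (c : Fin m → Fin n) :
    gapVariables K k c = X '' gapPositions k c := by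
  ext x
  constructor
  · rintro ⟨i, b, h1, h2, h3, rfl⟩
    exact ⟨(i, b), ⟨h1, h2, h3⟩, rfl⟩
  · rintro ⟨⟨i, b⟩, ⟨h1, h2, h3⟩, rfl⟩
    exact ⟨i, b, h1, h2, h3, rfl⟩

/-- Moving one column into the gap to its left gives a column sequence again. -/
theorem IsColumnSeq.update {k l : Fin n} {c : Fin m → Fin n} (hc : IsColumnSeq k l c)
    {i : Fin m} {b : Fin n} (h : (i, b) ∈ gapPositions k c) :
    IsColumnSeq k l (Function.update c i b) := by
  obtain ⟨hk, hprev, hlt⟩ := h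
  simp only at hk hprev hlt
  constructor
  · intro j j' hj
    rcases eq_or_ne j i with rfl | hji
    · rw [Function.update_self, Function.update_of_ne hj.ne']
      exact hlt.trans (hc.1 hj)
    · rw [Function.update_of_ne hji]
      rcases eq_or_ne j' i with rfl | hj'i
      · rw [Function.update_self]
        have hj0 : j.val < j'.val := hj
        have hlt' : j'.val - 1 < m := by omega
        refine lt_of_le_of_lt (hc.1.monotone (b := ⟨j'.val - 1, hlt'⟩) ?_)
          (hprev ⟨j'.val - 1, hlt'⟩ ?_)
        · rw [Fin.le_def]; simp only; omega
        · simp only; omega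
      · rw [Function.update_of_ne hj'i]
        exact hc.1 hj
  · intro j
    rcases eq_or_ne j i with rfl | hji
    · rw [Function.update_self]
      exact ⟨hk, hlt.le.trans (hc.2 j).2⟩
    · rw [Function.update_of_ne hji]
      exact hc.2 j

/-- If `c'` is not everywhere to the right of `c`, then in the first row where `c'` is to the left
of `c` its entry lies in a gap of `c`. -/
theorem IsColumnSeq.exists_mem_gapPositions {k l : Fin n} {c c' : Fin m → Fin n}
    (hc' : IsColumnSeq k l c') (h : ¬ c ≤ c') : ∃ i, (i, c' i) ∈ gapPositions k c := by
  have hex : ∃ i, c' i < c i := by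
    simpa [Pi.le_def] using h
  obtain ⟨i, hi, hmin⟩ := WellFounded.has_min (wellFounded_lt (α := Fin m)) {i | c' i < c i} hex
  refine ⟨i, (hc'.2 i).1, fun i' hi' => ?_, hi⟩
  have hlt : i' < i := by
    rw [Fin.lt_def]
    simp only at hi'
    omega
  exact (not_lt.1 fun h' => hmin i' h' hlt).trans_lt (hc'.1 hlt)

/-- The colon ideals are computed for every enumeration of the diagonal monomials in which a
column sequence comes later than those that are pointwise smaller: `hbefore` puts the gap variables
into the colon ideal, and `hnot` shows that they generate it. -/
theorem successiveColon_eq_span_gapVariables {K : Type*} [Field K] {k l : Fin n} {r : ℕ}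
    {f : Fin r → MvPolynomial (Fin m × Fin n) K} {u : Fin r} {c : Fin m → Fin n}
    (hc : IsColumnSeq k l c) (hu : f u = diagMonomial K c)
    (hbefore : ∀ c', IsColumnSeq k l c' → c' < c → ∃ v < u, f v = diagMonomial K c')
    (hnot : ∀ v < u, ∃ c', IsColumnSeq k l c' ∧ ¬ c ≤ c' ∧ f v = diagMonomial K c') :
    successiveColon f u = Ideal.span (gapVariables K k c) := by
  classical
  apply le_antisymm
  · intro p hp
    rw [successiveColon, Submodule.mem_colon_singleton, smul_eq_mul, hu,
      diagMonomial_eq_monomial] at hp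
    have hsub : Ideal.span (f '' Set.Iio u) ≤ Ideal.span ((fun s => monomial s (1 : K)) ''
        (diagExponent '' {c' | IsColumnSeq k l c' ∧ ¬ c ≤ c'})) := by
      refine Ideal.span_mono ?_
      rintro _ ⟨v, hv, rfl⟩
      obtain ⟨c', h1, h2, h3⟩ := hnot v hv
      exact ⟨_, ⟨c', ⟨h1, h2⟩, rfl⟩, by rw [h3, diagMonomial_eq_monomial]⟩
    have hp' := mem_ideal_span_monomial_image.1 (hsub hp)
    rw [gapVariables_eq_image, mem_ideal_span_X_image]
    intro x hx
    obtain ⟨_, ⟨c', ⟨h1, h2⟩, rfl⟩, hle⟩ := hp' (x + diagExponent c) (by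
      rw [mem_support_iff, coeff_mul_monomial, mul_one]
      exact mem_support_iff.1 hx)
    obtain ⟨i, hi⟩ := h1.exists_mem_gapPositions h2
    refine ⟨_, hi, ?_⟩
    have := hle (i, c' i)
    rw [Finsupp.add_apply, diagExponent_apply, diagExponent_apply, if_pos rfl,
      if_neg (ne_of_gt hi.2.2)] at this
    omega
  · rw [Ideal.span_le]
    rintro _ ⟨i, b, hk, hprev, hlt, rfl⟩
    rw [SetLike.mem_coe, successiveColon, Submodule.mem_colon_singleton, smul_eq_mul, hu]
    obtain ⟨v, hv, hfv⟩ := hbefore _ (hc.update (i := i) (b := b) ⟨hk, hprev, hlt⟩)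
      (update_lt_self_iff.2 hlt)
    -- Exchanging the factors in row `i` turns one diagonal monomial into a multiple of the other.
    have hprod : X (i, b) * diagMonomial K c = X (i, c i) * f v := by
      have hrest : ∏ j ∈ Finset.univ.erase i, (X (j, Function.update c i b j) : MvPolynomial _ K) =
          ∏ j ∈ Finset.univ.erase i, X (j, c j) :=
        Finset.prod_congr rfl fun j hj => by
          rw [Function.update_of_ne (Finset.ne_of_mem_erase hj)]
      rw [hfv, diagMonomial, diagMonomial, ← Finset.mul_prod_erase _ _ (Finset.mem_univ i),
        ← Finset.mul_prod_erase (a := i) _ (fun j => X (j, Function.update c i b j))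
          (Finset.mem_univ i), Function.update_self, hrest, mul_left_comm]
    rw [hprod]
    exact Ideal.mul_mem_left _ _ (Ideal.subset_span ⟨v, hv, rfl⟩)

theorem toSyn_diagExponent_anti {τ : MonomialOrder (Fin m × Fin n)} (hτ : IsRowDecreasing τ)
    {c c' : Fin m → Fin n} (h : c ≤ c') :
    τ.toSyn (diagExponent c') ≤ τ.toSyn (diagExponent c) := by
  simp only [diagExponent, map_sum]
  refine Finset.sum_le_sum fun i _ => ?_
  rcases (h i).eq_or_lt with he | hlt
  · rw [he]
  · exact (hτ i _ _ hlt).le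

theorem toSyn_diagExponent_strictAnti {τ : MonomialOrder (Fin m × Fin n)}
    (hτ : IsRowDecreasing τ) {c c' : Fin m → Fin n} (h : c < c') :
    τ.toSyn (diagExponent c') < τ.toSyn (diagExponent c) := by
  refine (toSyn_diagExponent_anti hτ h.le).lt_of_ne fun he => h.ne ?_
  have he' : diagExponent c' = diagExponent c := τ.toSyn.injective he
  funext i
  have := DFunLike.congr_fun he' (i, c i)
  rw [diagExponent_apply, diagExponent_apply, if_pos rfl] at this
  by_contra hne
  rw [if_neg (Ne.symm hne)] at this
  exact zero_ne_one this

theorem IsDecreasingEnumeration.successiveColon_eq {K : Type*} [Field K] {k l : Fin n}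
    {τ : MonomialOrder (Fin m × Fin n)} (hτ : IsRowDecreasing τ) {r : ℕ}
    {f : Fin r → MvPolynomial (Fin m × Fin n) K} (hf : IsDecreasingEnumeration τ k l f)
    {u : Fin r} {c : Fin m → Fin n} (hc : IsColumnSeq k l c) (hu : f u = diagMonomial K c) :
    successiveColon f u = Ideal.span (gapVariables K k c) := by
  classical
  have hdeg : ∀ (v : Fin r) (c' : Fin m → Fin n), f v = diagMonomial K c' →
      τ.degree (f v) = diagExponent c' := by
    intro v c' h
    rw [h, diagMonomial_eq_monomial, MonomialOrder.degree_monomial, if_neg one_ne_zero]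
  obtain ⟨hrange, hanti⟩ := hf
  refine successiveColon_eq_span_gapVariables hc hu (fun c' hc' hlt => ?_) fun v hv => ?_
  · obtain ⟨v, hv⟩ : diagMonomial K c' ∈ Set.range f := hrange ▸ ⟨c', hc', rfl⟩
    refine ⟨v, ?_, hv⟩
    rw [← hanti.lt_iff_gt]
    simp only [hdeg v c' hv, hdeg u c hu]
    exact toSyn_diagExponent_strictAnti hτ hlt
  · obtain ⟨c', hc', hv'⟩ : f v ∈ diagMonomials K m k l := hrange ▸ ⟨v, rfl⟩
    refine ⟨c', hc', fun hle => ?_, hv'⟩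
    have h1 := hanti hv
    simp only [hdeg v c' hv', hdeg u c hu] at h1
    exact (toSyn_diagExponent_anti hτ hle).not_gt h1

/-- The lexicographic order of the column sequences extends the pointwise order. -/
theorem exists_enumeration_columnSeq (m : ℕ) (k l : Fin n) :
    ∃ (r : ℕ) (C : Fin r → Fin m → Fin n),
      Set.range C = {c | IsColumnSeq k l c} ∧ C.Injective ∧ ∀ u v, C u < C v → u < v := by
  classical
  let s : Finset (Lex (Fin m → Fin n)) :=
    Finset.univ.filter fun c => IsColumnSeq k l (ofLex c)
  refine ⟨s.card, fun u => ofLex (s.orderEmbOfFin rfl u), ?_,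
    ofLex.injective.comp (s.orderEmbOfFin rfl).injective, fun u v h => ?_⟩
  · ext c
    constructor
    · rintro ⟨u, rfl⟩
      exact (Finset.mem_filter.1 (s.orderEmbOfFin_mem rfl u)).2
    · intro hc
      have : toLex c ∈ Set.range (s.orderEmbOfFin rfl) := by
        rw [Finset.range_orderEmbOfFin]
        exact Finset.mem_filter.2 ⟨Finset.mem_univ _, hc⟩
      obtain ⟨u, hu⟩ := this
      exact ⟨u, by simp only [hu, ofLex_toLex]⟩
  · exact (s.orderEmbOfFin rfl).lt_iff_lt.1 (Pi.toLex_strictMono h)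

/-- The diagonal monomials have an enumeration with colon ideals generated by gap variables. -/
theorem exists_enumeration_diagMonomials (K : Type*) [Field K] (m : ℕ) (k l : Fin n) :
    ∃ (r : ℕ) (C : Fin r → Fin m → Fin n),
      Ideal.span (Set.range fun u => diagMonomial K (C u)) = diagIdeal K m k l ∧
      ∀ u, successiveColon (fun u => diagMonomial K (C u)) u =
        Ideal.span (X '' gapPositions k (C u)) := by
  obtain ⟨r, C, hrange, hinj, hC⟩ := exists_enumeration_columnSeq m k l
  have hcol : ∀ u, IsColumnSeq k l (C u) := fun u => hrange.subset ⟨u, rfl⟩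
  refine ⟨r, C, ?_, fun u => ?_⟩
  · congr 1
    ext p
    constructor
    · rintro ⟨u, rfl⟩
      exact ⟨C u, hcol u, rfl⟩
    · rintro ⟨c, hc, rfl⟩
      obtain ⟨u, rfl⟩ := hrange.superset hc
      exact ⟨u, rfl⟩
  · rw [← gapVariables_eq_image]
    refine successiveColon_eq_span_gapVariables (hcol u) rfl (fun c' hc' hlt => ?_) fun v hv => ?_
    · obtain ⟨v, rfl⟩ := hrange.superset hc'
      exact ⟨v, hC v u hlt, rfl⟩
    · refine ⟨C v, hcol v, fun hle => ?_, rfl⟩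
      rcases hle.eq_or_lt with he | hlt
      · exact hv.ne' (hinj he)
      · exact hv.not_gt (hC u v hlt)

end Monomials

/-! ### Linear resolutions -/

section Resolutions

open Matrix

variable {σ K : Type*} [Field K]

/-- A homogeneous vector in the range of a homogeneous matrix has a homogeneous preimage. -/
theorem exists_isHomogeneous_mulVec_eq {α β : Type*} [Fintype β] {d e : ℕ}
    {A : Matrix α β (MvPolynomial σ K)} (hA : ∀ a b, (A a b).IsHomogeneous d)
    {w : α → MvPolynomial σ K} (hw : ∀ a, (w a).IsHomogeneous (d + e))
    (h : ∃ v, A *ᵥ v = w) :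
    ∃ v, (∀ b, (v b).IsHomogeneous e) ∧ A *ᵥ v = w := by
  obtain ⟨v, rfl⟩ := h
  refine ⟨fun b => homogeneousComponent e (v b),
    fun b => homogeneousComponent_isHomogeneous _ _, ?_⟩
  funext a
  rw [← homogeneousComponent_eq_self (hw a)]
  simp only [mulVec, dotProduct, map_sum]
  refine Finset.sum_congr rfl fun b _ => ?_
  let _ := MvPolynomial.gradedAlgebra (σ := σ) (R := K)
  have hcomp (p : MvPolynomial σ K) (i : ℕ) :
      (DirectSum.decompose (homogeneousSubmodule σ K) p i : MvPolynomial σ K) =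
        homogeneousComponent i p := decomposition.decompose'_apply p i
  have := DirectSum.coe_decompose_mul_add_of_left_mem (homogeneousSubmodule σ K) (i := d) (j := e)
    (a := A a b) (b := v b) (hA a b)
  rw [hcomp, hcomp] at this
  exact this.symm

/-- The columnwise version of `exists_isHomogeneous_mulVec_eq`, with a linear matrix as solution. -/
theorem exists_isHomogeneous_mul_eq {α β γ : Type*} [Fintype β] {d : ℕ}
    {A : Matrix α β (MvPolynomial σ K)} (hA : ∀ a b, (A a b).IsHomogeneous d)
    {B : Matrix α γ (MvPolynomial σ K)} (hB : ∀ a c, (B a c).IsHomogeneous (d + 1))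
    (h : ∀ c, ∃ v, A *ᵥ v = fun a => B a c) :
    ∃ T : Matrix β γ (MvPolynomial σ K), (∀ b c, (T b c).IsHomogeneous 1) ∧ A * T = B := by
  choose T hT hAT using fun c => exists_isHomogeneous_mulVec_eq hA (fun a => hB a c) (h c)
  refine ⟨fun b c => T c b, fun b c => hT c b, ?_⟩
  ext1 a c
  exact congrFun (hAT c) a

theorem isHomogeneous_mul_apply {α β γ : Type*} [Fintype β] {d e : ℕ}
    {A : Matrix α β (MvPolynomial σ K)} (hA : ∀ a b, (A a b).IsHomogeneous d)
    {B : Matrix β γ (MvPolynomial σ K)} (hB : ∀ b c, (B b c).IsHomogeneous e) (a : α) (c : γ) :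
    ((A * B) a c).IsHomogeneous (d + e) := by
  rw [Matrix.mul_apply]
  exact IsHomogeneous.sum _ _ _ fun b _ => (hA a b).mul (hB b c)

/-- The free modules of a linear resolution may be indexed by arbitrary finite types, and the
augmentation may be written as a matrix with one row. -/
theorem HasLinearResolution.of_fintype {d : ℕ} {I : Ideal (MvPolynomial σ K)} {ι : ℕ → Type}
    [∀ i, Fintype (ι i)] (g : Matrix Unit (ι 0) (MvPolynomial σ K))
    (M : ∀ i, Matrix (ι i) (ι (i + 1)) (MvPolynomial σ K))
    (hg : ∀ a b, (g a b).IsHomogeneous d) (hM : ∀ i a b, (M i a b).IsHomogeneous 1)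
    (hI : Ideal.span (Set.range (g ())) = I)
    (h0 : ∀ v, g *ᵥ v = 0 ↔ ∃ w, M 0 *ᵥ w = v)
    (hex : ∀ i v, M i *ᵥ v = 0 ↔ ∃ w, M (i + 1) *ᵥ w = v) :
    HasLinearResolution d I := by
  let e : ∀ i, Fin (Fintype.card (ι i)) ≃ ι i := fun i => (Fintype.equivFin (ι i)).symm
  -- Reindexing transports exactness, with the kernel condition `P` for one matrix read as `Q`.
  have key : ∀ {β γ : Type} [Fintype β] [Fintype γ] {b c : ℕ} (eb : Fin b ≃ β) (ec : Fin c ≃ γ)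
      (A : Matrix β γ (MvPolynomial σ K)) (P : (β → MvPolynomial σ K) → Prop)
      (Q : (Fin b → MvPolynomial σ K) → Prop) (hPQ : ∀ v, Q v ↔ P (v ∘ eb.symm))
      (hP : ∀ v, P v ↔ ∃ w, A *ᵥ w = v) (v : Fin b → MvPolynomial σ K),
      Q v ↔ v ∈ Set.range (A.submatrix eb ec).mulVecLin := by
    intro β γ _ _ b c eb ec A P Q hPQ hP v
    rw [hPQ, hP, Set.mem_range]
    constructor
    · rintro ⟨w, hw⟩
      refine ⟨w ∘ ec, ?_⟩
      rw [mulVecLin_apply, submatrix_mulVec_equiv]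
      funext x
      simp [Function.comp_assoc, hw]
    · rintro ⟨w, rfl⟩
      refine ⟨w ∘ ec.symm, ?_⟩
      rw [mulVecLin_apply, submatrix_mulVec_equiv]
      funext x
      simp
  refine ⟨fun i => Fintype.card (ι i), fun a => g () (e 0 a),
    fun i => (M i).submatrix (e i) (e (i + 1)), fun a => hg _ _, fun i a b => hM i _ _, ?_, ?_, ?_⟩
  · rw [← hI, ← (e 0).surjective.range_comp (g ())]
    rfl
  · refine key (e 0) (e 1) (M 0) (fun v => g *ᵥ v = 0) _ (fun v => ?_) h0
    rw [Fintype.linearCombination_apply, _root_.funext_iff]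
    have hsum : (g *ᵥ (v ∘ (e 0).symm)) () = ∑ a, v a • g () (e 0 a) := by
      rw [mulVec, dotProduct, ← (e 0).sum_comp]
      simp [mul_comm]
    rw [← hsum]
    exact ⟨fun H _ => H, fun H => H ()⟩
  · intro i
    refine key (e (i + 1)) (e (i + 2)) (M (i + 1)) (fun v => M i *ᵥ v = 0) _
      (fun v => ?_) (hex i)
    rw [mulVecLin_apply, submatrix_mulVec_equiv]
    constructor
    · intro h
      funext x
      simpa using congrFun h ((e i).symm x)
    · intro h
      rw [h]
      rfl

theorem hasLinearResolution_bot (d : ℕ) :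
    HasLinearResolution d (⊥ : Ideal (MvPolynomial σ K)) := by
  refine ⟨fun _ => 0, fun a => a.elim0, fun _ _ b => b.elim0, fun a => a.elim0,
    fun _ a => a.elim0, by simp, ?_, fun i => ?_⟩
  · exact fun v => ⟨fun _ => ⟨v, Subsingleton.elim _ _⟩, fun _ => by
      rw [Subsingleton.elim v 0, map_zero]⟩
  · exact fun v => ⟨fun _ => ⟨v, Subsingleton.elim _ _⟩, fun _ => Subsingleton.elim _ _⟩

/-- The comparison map in the mapping cone, from the complex `D` to the exact complex `M`: a first
component `T₀` with `T₀ * D 1` in the range of `M 0` extends to a sequence of linear matrices whose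
squares anticommute, the signs being those of the cone. -/
theorem exists_comparison {ι κ : ℕ → Type} [∀ i, Fintype (ι i)] [∀ i, Fintype (κ i)]
    (M : ∀ i, Matrix (ι i) (ι (i + 1)) (MvPolynomial σ K))
    (D : ∀ i, Matrix (κ i) (κ (i + 1)) (MvPolynomial σ K))
    (hM : ∀ i a b, (M i a b).IsHomogeneous 1) (hD : ∀ i a b, (D i a b).IsHomogeneous 1)
    (hex : ∀ i v, M i *ᵥ v = 0 → ∃ w, M (i + 1) *ᵥ w = v)
    (hDD : ∀ i, D i * D (i + 1) = 0)
    (T₀ : Matrix (ι 0) (κ 1) (MvPolynomial σ K)) (hT₀ : ∀ a b, (T₀ a b).IsHomogeneous 1)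
    (hlift : ∀ v, ∃ w, M 0 *ᵥ w = (T₀ * D 1) *ᵥ v) :
    ∃ T : ∀ i, Matrix (ι i) (κ (i + 1)) (MvPolynomial σ K), T 0 = T₀ ∧
      (∀ i a b, (T i a b).IsHomogeneous 1) ∧ ∀ i, M i * T (i + 1) = -(T i * D (i + 1)) := by
  classical
  -- The range condition is what makes a component extendable; the next component inherits it.
  let P : ∀ i, Type _ := fun i => {T : Matrix (ι i) (κ (i + 1)) (MvPolynomial σ K) //
    (∀ a b, (T a b).IsHomogeneous 1) ∧ ∀ v, ∃ w, M i *ᵥ w = (T * D (i + 1)) *ᵥ v}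
  have step : ∀ i (T : P i), ∃ T' : P (i + 1), M i * T'.1 = -(T.1 * D (i + 1)) := by
    rintro i ⟨T, hT, hTl⟩
    obtain ⟨T', hT', hMT⟩ := exists_isHomogeneous_mul_eq (hM i) (B := -(T * D (i + 1)))
      (fun a c => (isHomogeneous_mul_apply hT (hD _) a c).neg) (fun c => by
        obtain ⟨w, hw⟩ := hTl (Pi.single c 1)
        refine ⟨-w, ?_⟩
        rw [mulVec_neg, hw, mulVec_single_one]
        rfl)
    refine ⟨⟨T', hT', fun v => hex i _ ?_⟩, hMT⟩
    rw [mulVec_mulVec, ← Matrix.mul_assoc, hMT, Matrix.neg_mul, Matrix.mul_assoc, hDD,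
      Matrix.mul_zero, neg_zero, zero_mulVec]
  choose next hnext using step
  let T : ∀ i, P i := fun i => Nat.rec ⟨T₀, hT₀, hlift⟩ next i
  exact ⟨fun i => (T i).1, rfl, fun i => (T i).2.1, fun i => hnext i (T i)⟩

/-- A linear resolution of `J`, prolonged by the inclusion of `J` into `K[X]`: the generators of `J`
form the one row of the differential in degree zero. -/
theorem HasLinearResolution.exists_augmented {J : Ideal (MvPolynomial σ K)}
    (hJ : HasLinearResolution 1 J) :
    ∃ (κ : ℕ → ℕ) (a₀ : Fin (κ 0))
      (E : ∀ i, Matrix (Fin (κ i)) (Fin (κ (i + 1))) (MvPolynomial σ K)),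
      (∀ a, a = a₀) ∧ (∀ i a b, (E i a b).IsHomogeneous 1) ∧
      (∀ s, s a₀ ∈ J ↔ ∃ w, E 0 *ᵥ w = s) ∧
      ∀ i v, E i *ᵥ v = 0 ↔ ∃ w, E (i + 1) *ᵥ w = v := by
  obtain ⟨γ, h, D, hh, hD, rfl, hex0, hex⟩ := hJ
  refine ⟨fun i => Nat.casesOn i 1 γ, (0 : Fin 1), fun i =>
    Nat.casesOn i (fun (_ : Fin 1) b => h b) fun j => D j,
    fun a => Subsingleton.elim (α := Fin 1) _ _, ?_, fun s => ?_, ?_⟩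
  · rintro (_ | i) a b
    · exact hh b
    · exact hD i a b
  · rw [Ideal.mem_span_range_iff_exists_fun]
    refine exists_congr fun w => ?_
    rw [_root_.funext_iff]
    refine Iff.trans ?_ (Fin.forall_fin_one (p := fun a : Fin 1 => ∑ b, h b * w b = s a)).symm
    simp only [mul_comm (w _)]
  · rintro (_ | i) v
    · refine Iff.trans ?_ (hex0 v)
      rw [Fintype.linearCombination_apply, _root_.funext_iff]
      refine (Fin.forall_fin_one (p := fun _ : Fin 1 => ∑ b, h b * v b = 0)).trans ?_
      simp only [smul_eq_mul, mul_comm (v _)]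
    · exact hex i v

/-- The exactness argument for the mapping cone: the range of its next differential consists of the
vectors that are killed by the row `(A, T)` and have their second component in the range of `B'`.
At the augmentation this last condition follows from the first, and elsewhere it is the kernel
condition for the second row. -/
theorem add_mulVec_eq_zero_and_iff_exists_fromBlocks {R α β γ δ ε : Type*} [CommRing R]
    [Fintype β] [Fintype γ] [Fintype δ] [Fintype ε] {A : Matrix α β R} {T : Matrix α γ R}
    {A' : Matrix β δ R} {T' : Matrix β ε R} {B' : Matrix γ ε R}
    (hA : ∀ v, A *ᵥ v = 0 ↔ ∃ w, A' *ᵥ w = v) (hT : A * T' = -(T * B')) (v : β ⊕ γ → R) :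
    (A *ᵥ (v ∘ Sum.inl) + T *ᵥ (v ∘ Sum.inr) = 0 ∧ ∃ y, B' *ᵥ y = v ∘ Sum.inr) ↔
      ∃ w, fromBlocks A' T' 0 B' *ᵥ w = v := by
  have hker : ∀ (x : β → R) (y : ε → R), A *ᵥ (x - T' *ᵥ y) = A *ᵥ x + T *ᵥ (B' *ᵥ y) := by
    intro x y
    rw [mulVec_sub, mulVec_mulVec, hT, neg_mulVec, sub_neg_eq_add, mulVec_mulVec]
  constructor
  · rintro ⟨h, y, hy⟩
    rw [← hy, ← hker] at h
    obtain ⟨z, hz⟩ := (hA _).1 h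
    refine ⟨Sum.elim z y, ?_⟩
    rw [fromBlocks_mulVec, Sum.elim_comp_inl, Sum.elim_comp_inr, hz, hy, zero_mulVec, zero_add,
      sub_add_cancel, Sum.elim_comp_inl_inr]
  · rintro ⟨w, rfl⟩
    rw [fromBlocks_mulVec, Sum.elim_comp_inl, Sum.elim_comp_inr, zero_mulVec, zero_add]
    refine ⟨?_, _, rfl⟩
    rw [← hker, add_sub_cancel_right]
    exact (hA _).2 ⟨_, rfl⟩

/-- The mapping cone: a `d`-linear resolution of `I` and a `1`-linear resolution of `I : f`, the
latter prolonged to a resolution of `(I + ⟨f⟩) / I`, combine to a `d`-linear resolution of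
`I + ⟨f⟩`. -/
theorem HasLinearResolution.sup_span_singleton {d : ℕ} {I : Ideal (MvPolynomial σ K)}
    (hI : HasLinearResolution d I) {f : MvPolynomial σ K} (hf : f.IsHomogeneous d)
    (hL : HasLinearResolution 1 (I.colon {f})) :
    HasLinearResolution d (I ⊔ Ideal.span {f}) := by
  obtain ⟨β, g, M, hg, hM, hgI, hex0, hex⟩ := hI
  obtain ⟨κ, a₀, E, ha₀, hE, hEL, hEex⟩ := hL.exists_augmented
  have hEE : ∀ i, E i * E (i + 1) = 0 := fun i => by
    classical
    refine Matrix.ext_of_mulVec_single fun c => ?_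
    rw [← mulVec_mulVec, zero_mulVec]
    exact (hEex i _).2 ⟨_, rfl⟩
  have hEcolon (s : Fin (κ 0) → MvPolynomial σ K) : s a₀ * f ∈ I ↔ ∃ w, E 0 *ᵥ w = s := by
    rw [← hEL, Submodule.mem_colon_singleton, smul_eq_mul]
  let G : Matrix Unit (Fin (β 0)) (MvPolynomial σ K) := fun _ b => g b
  have hG : ∀ a b, (G a b).IsHomogeneous d := fun _ b => hg b
  have hGex : ∀ v, G *ᵥ v = 0 ↔ ∃ w, M 0 *ᵥ w = v := fun v => by
    refine Iff.trans ?_ (hex0 v)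
    rw [Fintype.linearCombination_apply, _root_.funext_iff]
    simp only [smul_eq_mul, mul_comm (v _)]
    exact ⟨fun H => H (), fun H _ => H⟩
  have hGI : ∀ p : Unit → MvPolynomial σ K, p () ∈ I ↔ ∃ v, G *ᵥ v = p := fun p => by
    rw [← hgI, Ideal.mem_span_range_iff_exists_fun]
    refine exists_congr fun w => ?_
    rw [_root_.funext_iff]
    simp only [mul_comm (w _)]
    exact ⟨fun H _ => H, fun H => H ()⟩
  let F : Matrix Unit (Fin (κ 0)) (MvPolynomial σ K) := fun _ _ => f
  have hF : ∀ a b, (F a b).IsHomogeneous d := fun _ _ => hf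
  have hFs (s : Fin (κ 0) → MvPolynomial σ K) : (F *ᵥ s) () = s a₀ * f := by
    rw [mulVec, dotProduct, Finset.sum_eq_single a₀ (fun a _ h => absurd (ha₀ a) h)
      (fun h => absurd (Finset.mem_univ _) h), mul_comm]
  obtain ⟨T₀, hT₀, hGT₀⟩ := exists_isHomogeneous_mul_eq hG (B := -(F * E 0))
    (fun a c => (isHomogeneous_mul_apply hF (hE 0) a c).neg) (fun c => by
      classical
      refine (hGI _).1 ?_
      have h1 := (hEcolon (E 0 *ᵥ Pi.single c 1)).2 ⟨_, rfl⟩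
      rw [← hFs, mulVec_mulVec, mulVec_single_one] at h1
      exact I.neg_mem h1)
  obtain ⟨T, rfl, hT, hMT⟩ := exists_comparison (ι := fun i => Fin (β i))
    (κ := fun i => Fin (κ i)) M E hM hE (fun i v => (hex i v).1) hEE T₀ hT₀
    (fun v => (hGex _).1 (by
      rw [mulVec_mulVec, ← Matrix.mul_assoc, hGT₀, Matrix.neg_mul, Matrix.mul_assoc, hEE,
        Matrix.mul_zero, neg_zero, zero_mulVec]))
  refine HasLinearResolution.of_fintype (ι := fun i => Fin (β i) ⊕ Fin (κ i)) (fromCols G F)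
    (fun i => fromBlocks (M i) (T i) 0 (E i)) ?_ ?_ ?_ ?_ ?_
  · rintro a (b | b)
    · exact hG a b
    · exact hF a b
  · rintro i (a | a) (b | b)
    · exact hM i a b
    · exact hT i a b
    · exact isHomogeneous_zero _ _ _
    · exact hE i a b
  · rw [← hgI, ← Ideal.span_union]
    congr 1
    ext p
    constructor
    · rintro ⟨b | b, rfl⟩
      · exact Or.inl ⟨b, rfl⟩
      · exact Or.inr rfl
    · rintro (⟨b, rfl⟩ | rfl)
      · exact ⟨Sum.inl b, rfl⟩
      · exact ⟨Sum.inr a₀, rfl⟩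
  · intro v
    rw [← add_mulVec_eq_zero_and_iff_exists_fromBlocks hGex hGT₀, fromCols_mulVec]
    refine (and_iff_left_of_imp fun h => (hEcolon _).1 ?_).symm
    rw [← hFs, eq_neg_of_add_eq_zero_right h]
    exact I.neg_mem ((hGI _).2 ⟨_, rfl⟩)
  · intro i v
    rw [← add_mulVec_eq_zero_and_iff_exists_fromBlocks (hex i) (hMT i), fromBlocks_mulVec,
      ← hEex, zero_mulVec, zero_add, ← Sum.elim_zero_zero, Sum.elim_eq_iff]

/-- Successive cones along the colon ideals resolve an ideal with linear quotients. -/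
theorem hasLinearResolution_span_range {d r : ℕ} {f : Fin r → MvPolynomial σ K}
    (hf : ∀ u, (f u).IsHomogeneous d) (h : ∀ u, HasLinearResolution 1 (successiveColon f u)) :
    HasLinearResolution d (Ideal.span (Set.range f)) := by
  have key : ∀ t ≤ r, HasLinearResolution d (Ideal.span (f '' {u | u.val < t})) := by
    intro t
    induction t with
    | zero =>
      intro _
      simpa using hasLinearResolution_bot d
    | succ t ih =>
      intro ht
      have hset : {u : Fin r | u.val < t + 1} = {u | u.val < t} ∪ {⟨t, ht⟩} := by
        ext u
        simp only [Set.mem_ofPred_eq, Set.mem_union, Set.mem_singleton_iff, Fin.ext_iff]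
        omega
      rw [hset, Set.image_union, Set.image_singleton, Ideal.span_union]
      exact (ih (by omega)).sup_span_singleton (hf _) (h ⟨t, ht⟩)
  have hset : {u : Fin r | u.val < r} = Set.univ := Set.eq_univ_of_forall fun u => u.isLt
  simpa only [hset, Set.image_univ] using key r le_rfl

/-- A variable outside of `s` is a nonzerodivisor modulo the ideal generated by the variables in
`s`. -/
theorem colon_span_X_image {s : Set σ} {a : σ} (ha : a ∉ s) :
    (Ideal.span (X '' s : Set (MvPolynomial σ K))).colon {X a} = Ideal.span (X '' s) := by
  classical
  ext p
  rw [Submodule.mem_colon_singleton, smul_eq_mul]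
  refine ⟨fun h => ?_, fun h => Ideal.mul_mem_right _ _ h⟩
  rw [mem_ideal_span_X_image] at h ⊢
  intro x hx
  obtain ⟨i, hi, hne⟩ := h (x + Finsupp.single a 1) (by
    rw [mem_support_iff, coeff_mul_X]
    exact mem_support_iff.1 hx)
  refine ⟨i, hi, ?_⟩
  rwa [Finsupp.add_apply, Finsupp.single_eq_of_ne (ne_of_mem_of_not_mem hi ha), add_zero] at hne

/-- This is the Koszul resolution, obtained by adjoining one variable after the other. -/
theorem hasLinearResolution_span_X_image {s : Set σ} (hs : s.Finite) :
    HasLinearResolution 1 (Ideal.span (X '' s : Set (MvPolynomial σ K))) := by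
  induction s, hs using Set.Finite.induction_on with
  | empty => simpa using hasLinearResolution_bot 1
  | @insert a s ha _ ih =>
    rw [Set.image_insert_eq, Ideal.span_insert, sup_comm]
    exact ih.sup_span_singleton (isHomogeneous_X K a) (by rwa [colon_span_X_image ha])

end Resolutions

end DiagonalIdeals

/-! ### The diagonal ideal -/

theorem mainTheorem2 {K : Type*} [Field K] (m n : ℕ) (k l : Fin n) (hkl : k ≤ l)
    (hm : m ≤ l.val - k.val + 1) :
    (∀ τ : MonomialOrder (Fin m × Fin n), DiagonalIdeals.IsRowDecreasing τ →
      ∀ (r : ℕ) (f : Fin r → MvPolynomial (Fin m × Fin n) K),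
        DiagonalIdeals.IsDecreasingEnumeration τ k l f →
        ∀ (u : Fin r) (c : Fin m → Fin n), DiagonalIdeals.IsColumnSeq k l c →
          f u = DiagonalIdeals.diagMonomial K c →
          DiagonalIdeals.successiveColon f u =
            Ideal.span (DiagonalIdeals.gapVariables K k c)) ∧
    DiagonalIdeals.HasLinearQuotients (DiagonalIdeals.diagIdeal K m k l) ∧
    DiagonalIdeals.HasLinearResolution m (DiagonalIdeals.diagIdeal K m k l) := by
  obtain ⟨r, C, hspan, hcolon⟩ := DiagonalIdeals.exists_enumeration_diagMonomials K m k l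
  refine ⟨fun τ hτ r f hf u c hc hu => hf.successiveColon_eq hτ hc hu, ?_, ?_⟩
  · refine ⟨r, _, hspan, fun u _ => ⟨_, ?_, hcolon u⟩⟩
    rintro _ ⟨p, _, rfl⟩
    exact MvPolynomial.isHomogeneous_X K p
  · rw [← hspan]
    refine DiagonalIdeals.hasLinearResolution_span_range
      (fun u => DiagonalIdeals.isHomogeneous_diagMonomial K (C u)) fun u => ?_
    rw [hcolon u]
    exact DiagonalIdeals.hasLinearResolution_span_X_image (Set.toFinite _)
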